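/- Let $\nu$ be a nonzero finite positive Borel measure on $[0,1]$, let $\mathbb D$ be the open unit disk with normalized area measure $dA$, and let $T_\nu$ be the integral operator \[ T_\nu f(z)=\int_{\mathbb D}\frac{1}{1-z\overline{\lambda}}\left(\int_0^1\frac{d\nu(r)}{1-rz\overline{\lambda}}\right)f(\lambda)\,dA(\lambda),\qquad z\in\mathbb D . \] For $c\in[1,\infty]$ let $c'$ denote the dual exponent, $1/c+1/c'=1$, and put \[ c_\nu=\sup\left\{1\le c<2:\ \int_0^1\frac{d\nu(r)}{(1-r^2)^{2/c'}}<\infty\right\}\in[1,2] \] (for $c=1$ the integrand is identically $1$; for $c>1$ it equals $+\infty$ at $r=1$). Let $p,q\in[1,\infty]$ be such that $(1/p,1/q)$ does not lie on the critical segment \[ \left\{\left(\frac1p,\frac1q\right):\ 1\le p\le c_\nu',\ \frac1q=\frac1p+\frac1{c_\nu}-1\right\}. \] Then $T_\nu:L^p(\mathbb D,dA)\to L^q(\mathbb D,dA)$ is bounded if and only if one of the following holds: (a) $p=1$ and $q<c_\nu$; (b) $1<p<c_\nu'$ and $\frac1q>\frac1p+\frac1{c_\nu}-1$; (c) $p=c_\nu'$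 and $q<\infty$; (d) $p>c_\nu'$ (and $q\in[1,\infty]$ arbitrary). -/

import Mathlib

open MeasureTheory
open scoped ENNReal NNReal ComplexConjugate

noncomputable section

namespace Shimorin

/-- The normalized area measure of the open unit disk, as a measure on `ℂ` carried by the disk. -/
def diskMeasure : Measure ℂ :=
  (ENNReal.ofReal Real.pi)⁻¹ • (volume : Measure ℂ).restrict (Metric.ball 0 1)

/-- The kernel `K_ν(z, w) = (1 - z w̄)⁻¹ ∫ (1 - r z w̄)⁻¹ dν(r)`. -/
def kernel (ν : Measure unitInterval) (z w : ℂ) : ℂ :=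
  1 / (1 - z * conj w) * ∫ r : unitInterval, 1 / (1 - ((r : ℝ) : ℂ) * z * conj w) ∂ν

/-- The Shimorin-type integral operator `T_ν`. -/
def operator (ν : Measure unitInterval) (f : ℂ → ℂ) (z : ℂ) : ℂ :=
  ∫ w, kernel ν z w * f w ∂diskMeasure

/-- `T_ν` is bounded from `L^p` to `L^q` of the disk. -/
def IsBoundedLpLq (ν : Measure unitInterval) (p q : ℝ≥0∞) : Prop :=
  ∃ C : ℝ≥0, ∀ f : ℂ → ℂ, MemLp f p diskMeasure →
    MemLp (operator ν f) q diskMeasure ∧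
      eLpNorm (operator ν f) q diskMeasure ≤ C * eLpNorm f p diskMeasure

/-- The critical index `c_ν = sup {1 ≤ c < 2 : ∫ (1 - r²)^(-2/c') dν(r) < ∞}`, where `c'` is the
dual exponent of `c` (with `1' = ∞`). The integrand takes values in `[0, ∞]`: at `r = 1` it is
`∞` for `c > 1` and `1` for `c = 1`. -/
def criticalIndex (ν : Measure unitInterval) : ℝ≥0∞ :=
  sSup {c : ℝ≥0∞ | 1 ≤ c ∧ c < 2 ∧
    ∫⁻ r : unitInterval,
      1 / ENNReal.ofReal (1 - (r : ℝ) ^ 2) ^ (2 / c.conjExponent).toReal ∂ν < ∞}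

/-- The set of exponents `(p, q)` for which `(1/p, 1/q)` lies on the critical segment
`1/q = 1/p + 1/c_ν - 1`, `1 ≤ p ≤ c_ν'`. -/
def criticalLine (ν : Measure unitInterval) : Set (ℝ≥0∞ × ℝ≥0∞) :=
  {x | 1 ≤ x.1 ∧ x.1 ≤ (criticalIndex ν).conjExponent ∧ 1 ≤ x.2 ∧
    (1 / x.2).toReal = (1 / x.1).toReal + (1 / criticalIndex ν).toReal - 1}

end Shimorin

end

/-! Write x = 1/p, y = 1/q, t = 1/c_ν. The claim is that, off the critical segment, boundedness is
governed by the sign of y - (x + t - 1), with every y allowed once x < 1 - t.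

Sufficiency uses only the size of the kernel. For u = z w̄, the quantity |1 - ru| dominates both |1
- u|/2 and (1 - r²)/2, hence their weighted geometric means. If (1 - r²)^(-2(1-s)) is ν-integrable,
this gives |K_ν| ≤ C |1 - z w̄|^(-2s) (`exists_enorm_kernel_le`). Powers of |1 - z w̄|⁻¹ below the
second are uniformly integrable over the disk, so Young's inequality (`lintegral_kernel_rpow_le`)
applies with 1/c = 1 + y - x > s, and s may be taken arbitrarily close to t when t < 1. If t = 1,
only the kernel |1 - z w̄|⁻² is available. Then x < y, and this strict loss pays for a small power
of 1 - |w| (`isPowerBounded_two`).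

Necessity comes from testing on the indicator of a disk of radius comparable to δ about 1 - δ. There
the real part of K_ν is at least a multiple of δ⁻¹ ∫ dν(r)/(1 - r + δ), with no cancellation. So
boundedness forces δ ∫ dν(r)/(1 - r + δ) ≤ C δ^(2(x-y)) (`IsBoundedLpLq.exists_mul_integral_le`).
This bounds x - y by 1/2, because ν ≠ 0. It also bounds the ν-mass near 1, and summing over dyadic
shells yields t ≤ 1 - (x - y). Excluding the critical segment makes this inequality strict where
needed. -/

namespace Shimorin

open Metric

/-! ### Integral inequalities for positive kernels -/

/-- Young's inequality for integral operators with a positive kernel, `1/c = 1 + 1/q - 1/p`. -/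
theorem lintegral_kernel_rpow_le {α : Type*} [MeasurableSpace α] {μ : Measure α} [SFinite μ]
    {k : α → α → ℝ≥0∞} (hk : Measurable (Function.uncurry k)) {A : ℝ≥0∞} {p q c : ℝ}
    (hp : 1 ≤ p) (hpq : p ≤ q) (hc : 0 < c) (hpqc : c⁻¹ = 1 + q⁻¹ - p⁻¹)
    (h₁ : ∀ᵐ w ∂μ, ∫⁻ z, k z w ^ c ∂μ ≤ A) (h₂ : ∀ᵐ z ∂μ, ∫⁻ w, k z w ^ c ∂μ ≤ A)
    {g : α → ℝ≥0∞} (hg : AEMeasurable g μ) :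
    (∫⁻ z, (∫⁻ w, k z w * g w ∂μ) ^ q ∂μ) ^ (1 / q) ≤
      A ^ c⁻¹ * (∫⁻ w, g w ^ p ∂μ) ^ (1 / p) := by
  have hp0 : 0 < p := by linarith
  have hq0 : 0 < q := by linarith
  have hip : p⁻¹ ≤ 1 := inv_le_one_of_one_le₀ hp
  have hiq : q⁻¹ ≤ p⁻¹ := inv_anti₀ hp0 hpq
  have hcq : 0 ≤ c⁻¹ - q⁻¹ := by linarith
  have hpq' : 0 ≤ p⁻¹ - q⁻¹ := by linarith
  set G := ∫⁻ w, g w ^ p ∂μ with hG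
  have hkz : ∀ z, Measurable (k z) := fun z => hk.of_uncurry_left
  have hpt : ∀ᵐ z ∂μ, (∫⁻ w, k z w * g w ∂μ) ^ q ≤
      (∫⁻ w, k z w ^ c * g w ^ p ∂μ) * (A ^ (c⁻¹ - q⁻¹) * G ^ (p⁻¹ - q⁻¹)) ^ q := by
    filter_upwards [h₂] with z hz
    have hle : ∫⁻ w, k z w * g w ∂μ ≤
        (∫⁻ w, k z w ^ c * g w ^ p ∂μ) ^ q⁻¹ * (A ^ (c⁻¹ - q⁻¹) * G ^ (p⁻¹ - q⁻¹)) := by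
      -- Hölder for k g = (k^c g^p)^(1/q) (k^c)^(1/c - 1/q) (g^p)^(1/p - 1/q). The three outer
      -- exponents add up to 1 exactly by `hpqc`.
      have := ENNReal.lintegral_prod_norm_pow_le (μ := μ) Finset.univ
        (f := ![fun w => k z w ^ c * g w ^ p, fun w => k z w ^ c, fun w => g w ^ p])
        (p := ![q⁻¹, c⁻¹ - q⁻¹, p⁻¹ - q⁻¹])
        (by
          intro i _
          fin_cases i
          · exact ((hkz z).aemeasurable.pow_const c).mul (hg.pow_const p)
          · exact (hkz z).aemeasurable.pow_const c
          · exact hg.pow_const p)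
        (by simp [Fin.sum_univ_three]; linarith)
        (by
          intro i _
          fin_cases i
          · simpa using hq0.le
          · exact hcq
          · exact hpq')
      simp only [Fin.prod_univ_three, Matrix.cons_val_zero, Matrix.cons_val_one,
        Matrix.cons_val] at this
      calc ∫⁻ w, k z w * g w ∂μ = ∫⁻ w, (k z w ^ c * g w ^ p) ^ q⁻¹ *
            (k z w ^ c) ^ (c⁻¹ - q⁻¹) * (g w ^ p) ^ (p⁻¹ - q⁻¹) ∂μ := by
            congr 1 with w
            rw [ENNReal.mul_rpow_of_nonneg _ _ (by positivity), mul_assoc, mul_mul_mul_comm,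
              ← ENNReal.rpow_add_of_nonneg _ _ (by positivity) hcq,
              ← ENNReal.rpow_add_of_nonneg _ _ (by positivity) hpq']
            simp [← ENNReal.rpow_mul, hc.ne', hp0.ne']
        _ ≤ _ := this
        _ ≤ _ := by
          rw [mul_assoc]
          gcongr
    calc (∫⁻ w, k z w * g w ∂μ) ^ q ≤ _ := ENNReal.rpow_le_rpow hle hq0.le
      _ = _ := by
        rw [ENNReal.mul_rpow_of_nonneg _ _ hq0.le, ← ENNReal.rpow_mul, inv_mul_cancel₀ hq0.ne',
          ENNReal.rpow_one]
  have hmeas : AEMeasurable (Function.uncurry fun z w => k z w ^ c * g w ^ p) (μ.prod μ) :=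
    (hk.aemeasurable.pow_const c).mul ((hg.comp_snd).pow_const p)
  have hfub : ∫⁻ z, ∫⁻ w, k z w ^ c * g w ^ p ∂μ ∂μ ≤ A * G := by
    rw [lintegral_lintegral_swap hmeas]
    calc ∫⁻ w, ∫⁻ z, k z w ^ c * g w ^ p ∂μ ∂μ ≤ ∫⁻ w, A * g w ^ p ∂μ := by
          refine lintegral_mono_ae ?_
          filter_upwards [h₁] with w hw
          rw [lintegral_mul_const _ (by exact (hk.of_uncurry_right).pow_const c)]
          gcongr
      _ = A * G := by rw [lintegral_const_mul'' _ (hg.pow_const p)]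
  have hone : ∫⁻ z, (∫⁻ w, k z w * g w ∂μ) ^ q ∂μ ≤
      A * G * (A ^ (c⁻¹ - q⁻¹) * G ^ (p⁻¹ - q⁻¹)) ^ q := by
    calc _ ≤ ∫⁻ z, (∫⁻ w, k z w ^ c * g w ^ p ∂μ) *
          (A ^ (c⁻¹ - q⁻¹) * G ^ (p⁻¹ - q⁻¹)) ^ q ∂μ := lintegral_mono_ae hpt
      _ = (∫⁻ z, ∫⁻ w, k z w ^ c * g w ^ p ∂μ ∂μ) *
          (A ^ (c⁻¹ - q⁻¹) * G ^ (p⁻¹ - q⁻¹)) ^ q := by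
          exact lintegral_mul_const'' _ hmeas.lintegral_prod_right'
      _ ≤ _ := by gcongr
  calc _ ≤ (A * G * (A ^ (c⁻¹ - q⁻¹) * G ^ (p⁻¹ - q⁻¹)) ^ q) ^ (1 / q) :=
        ENNReal.rpow_le_rpow hone (by positivity)
    _ = A ^ q⁻¹ * G ^ q⁻¹ * (A ^ (c⁻¹ - q⁻¹) * G ^ (p⁻¹ - q⁻¹)) := by
        rw [ENNReal.mul_rpow_of_nonneg _ _ (by positivity), ← ENNReal.rpow_mul,
          mul_one_div_cancel hq0.ne', ENNReal.rpow_one, one_div,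
          ENNReal.mul_rpow_of_nonneg _ _ (by positivity)]
    _ = A ^ c⁻¹ * G ^ (1 / p) := by
        rw [mul_mul_mul_comm, ← ENNReal.rpow_add_of_nonneg _ _ (by positivity) hcq,
          ← ENNReal.rpow_add_of_nonneg _ _ (by positivity) hpq', one_div]
        congr 2 <;> ring

/-- Hölder's inequality, serving as the endpoint q = ∞ of Young's inequality. -/
theorem lintegral_kernel_le_of_conj {α : Type*} [MeasurableSpace α] {μ : Measure α}
    {k g : α → ℝ≥0∞} (hk : AEMeasurable k μ) (hg : AEMeasurable g μ) {A : ℝ≥0∞} {p c : ℝ}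
    (hpc : p.HolderConjugate c) (h : ∫⁻ w, k w ^ c ∂μ ≤ A) :
    ∫⁻ w, k w * g w ∂μ ≤ A ^ (1 / c) * (∫⁻ w, g w ^ p ∂μ) ^ (1 / p) := by
  have hc := hpc.symm.pos
  refine (ENNReal.lintegral_mul_le_Lp_mul_Lq μ hpc.symm hk hg).trans ?_
  gcongr

/-! ### The disk measure and integrals of powers over the disk -/

instance isProbabilityMeasure_diskMeasure : IsProbabilityMeasure diskMeasure := by
  constructor
  have h : (ENNReal.ofReal Real.pi) ≠ 0 := by simp [Real.pi_pos]
  have h' : (volume : Measure ℂ) (ball 0 1) = ENNReal.ofReal Real.pi := by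
    rw [Complex.volume_ball]
    simp [← NNReal.coe_real_pi]
  simp [diskMeasure, h', ENNReal.inv_mul_cancel h]

theorem ae_diskMeasure_mem_ball : ∀ᵐ z ∂diskMeasure, z ∈ ball (0 : ℂ) 1 :=
  Measure.ae_smul_measure (ae_restrict_mem measurableSet_ball) _

theorem lintegral_diskMeasure (f : ℂ → ℝ≥0∞) :
    ∫⁻ z, f z ∂diskMeasure = (ENNReal.ofReal Real.pi)⁻¹ * ∫⁻ z in ball 0 1, f z := by
  simp [diskMeasure, lintegral_smul_measure]

theorem lintegral_diskMeasure_lt_top {f : ℂ → ℝ≥0∞} (h : ∫⁻ z in ball 0 1, f z < ∞) :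
    ∫⁻ z, f z ∂diskMeasure < ∞ := by
  rw [lintegral_diskMeasure]
  exact ENNReal.mul_lt_top (by simp [Real.pi_pos]) h

theorem lintegral_ball_enorm_rpow_lt_top {β : ℝ} (hβ : β < 2) (r : ℝ) :
    ∫⁻ z in ball (0 : ℂ) r, ‖z‖ₑ ^ (-β) < ∞ := by
  have h : IntegrableOn (fun z : ℂ => ‖z‖ ^ (-β)) (ball 0 r) :=
    integrableOn_ball_of_norm_le_rpow (C := 1) (α := β) (by simp) (by simpa using hβ)
      (ae_of_all _ fun z => by simp [abs_of_nonneg (Real.rpow_nonneg (norm_nonneg z) _)])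
      (measurable_norm.pow_const _).aestronglyMeasurable
  refine lt_of_le_of_lt (lintegral_mono_ae ?_) h.2
  refine ae_restrict_of_ae ?_
  filter_upwards [compl_mem_ae_iff.2 (measure_singleton (0 : ℂ))] with z hz
  have hz' : 0 < ‖z‖ := norm_pos_iff.2 hz
  rw [Real.enorm_eq_ofReal (by positivity), ← ENNReal.ofReal_rpow_of_pos hz', ofReal_norm]

theorem norm_one_sub_mul_conj_comm (z w : ℂ) : ‖1 - z * conj w‖ = ‖1 - w * conj z‖ := by
  rw [← Complex.norm_conj]
  simp [mul_comm]

theorem enorm_one_sub_mul_conj_comm (z w : ℂ) : ‖1 - z * conj w‖ₑ = ‖1 - w * conj z‖ₑ := by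
  rw [← ofReal_norm, norm_one_sub_mul_conj_comm, ofReal_norm]

theorem one_sub_norm_le {z w : ℂ} (hz : ‖z‖ ≤ 1) : 1 - ‖w‖ ≤ ‖1 - z * conj w‖ := by
  have h1 := norm_sub_norm_le (1 : ℂ) (z * conj w)
  have h2 : ‖z * conj w‖ ≤ ‖w‖ := by
    rw [norm_mul, Complex.norm_conj]
    nlinarith [norm_nonneg w]
  rw [norm_one] at h1
  linarith

/-- The uniform integrability of the powers `‖1 - z w̄‖ ^ (-β)`, `β < 2`, over the disk. -/
theorem exists_lintegral_enorm_one_sub_rpow_le {β : ℝ} (h0 : 0 ≤ β) (hβ : β < 2) :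
    ∃ A : ℝ≥0, ∀ w ∈ ball (0 : ℂ) 1, ∫⁻ z, ‖1 - z * conj w‖ₑ ^ (-β) ∂diskMeasure ≤ A := by
  set M := (2 : ℝ≥0∞) ^ β * (1 + (ENNReal.ofReal Real.pi)⁻¹ *
    ∫⁻ z in ball (0 : ℂ) 3, ‖z‖ₑ ^ (-β)) with hM
  have hMtop : M ≠ ∞ := by
    have := (lintegral_ball_enorm_rpow_lt_top hβ 3).ne
    have h2 : (ENNReal.ofReal Real.pi)⁻¹ ≠ ∞ := by simp [Real.pi_pos]
    have h3 : (2 : ℝ≥0∞) ^ β ≠ ∞ := by simp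
    finiteness
  refine ⟨M.toNNReal, fun w hw => ?_⟩
  rw [ENNReal.coe_toNNReal hMtop]
  have hw1 : ‖w‖ < 1 := by simpa using hw
  -- For small w the integrand is bounded. Otherwise 1 - z w̄ = w̄ (a - z) with a = 1/w̄ and |a| ≤
  -- 2, and a translation moves the singularity to the origin, with the disk landing inside radius
  -- 3.
  rcases le_total ‖w‖ (1 / 2) with hw2 | hw2
  · calc ∫⁻ z, ‖1 - z * conj w‖ₑ ^ (-β) ∂diskMeasure ≤ ∫⁻ _, 2 ^ β ∂diskMeasure := by
          refine lintegral_mono_ae ?_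
          filter_upwards [ae_diskMeasure_mem_ball] with z hz
          have h := one_sub_norm_le (w := w) (mem_ball_zero_iff.1 hz).le
          rw [ENNReal.rpow_neg, ← ENNReal.inv_rpow]
          refine ENNReal.rpow_le_rpow ?_ h0
          rw [ENNReal.inv_le_iff_inv_le, ← ofReal_norm]
          calc (2 : ℝ≥0∞)⁻¹ = ENNReal.ofReal (1 / 2) := by
                rw [one_div, ENNReal.ofReal_inv_of_pos two_pos]; simp
            _ ≤ _ := ENNReal.ofReal_le_ofReal (by linarith)
      _ = 2 ^ β * 1 := by simp
      _ ≤ M := by rw [hM]; gcongr; simp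
  · have hw0 : conj w ≠ 0 := by
      rw [Ne, map_eq_zero]
      rintro rfl
      norm_num at hw2
    set a := (conj w)⁻¹ with ha
    have haw : ‖a‖ ≤ 2 := by
      rw [ha, norm_inv, Complex.norm_conj]
      exact inv_le_of_inv_le₀ two_pos (by simpa using hw2)
    have hpt : ∀ z : ℂ, ‖1 - z * conj w‖ₑ ^ (-β) ≤ 2 ^ β * ‖a - z‖ₑ ^ (-β) := by
      intro z
      have h1 : 1 - z * conj w = conj w * (a - z) := by
        rw [ha]; field_simp
      have h2 : (2 : ℝ≥0∞)⁻¹ ≤ ‖conj w‖ₑ := by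
        rw [← ofReal_norm, Complex.norm_conj]
        calc (2 : ℝ≥0∞)⁻¹ = ENNReal.ofReal (1 / 2) := by
              rw [one_div, ENNReal.ofReal_inv_of_pos two_pos]; simp
          _ ≤ _ := ENNReal.ofReal_le_ofReal hw2
      rw [h1, enorm_mul, ENNReal.rpow_neg, ENNReal.rpow_neg, ← ENNReal.inv_rpow,
        ← ENNReal.inv_rpow, ENNReal.mul_inv (by simp) (by simp),
        ENNReal.mul_rpow_of_nonneg _ _ h0]
      gcongr
      rwa [ENNReal.inv_le_iff_inv_le]
    calc ∫⁻ z, ‖1 - z * conj w‖ₑ ^ (-β) ∂diskMeasure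
        ≤ ∫⁻ z, 2 ^ β * ‖a - z‖ₑ ^ (-β) ∂diskMeasure := lintegral_mono hpt
      _ = 2 ^ β * ((ENNReal.ofReal Real.pi)⁻¹ * ∫⁻ z in ball 0 1, ‖a - z‖ₑ ^ (-β)) := by
          rw [lintegral_const_mul _ (by fun_prop), lintegral_diskMeasure]
      _ ≤ 2 ^ β * ((ENNReal.ofReal Real.pi)⁻¹ * ∫⁻ z in ball (0 : ℂ) 3, ‖z‖ₑ ^ (-β)) := by
          gcongr _ * (_ * ?_)
          rw [← lintegral_indicator measurableSet_ball, ← lintegral_indicator measurableSet_ball,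
            ← lintegral_sub_left_eq_self _ a]
          refine lintegral_mono fun z => ?_
          by_cases hz : a - z ∈ ball (0 : ℂ) 1
          · have hz3 : z ∈ ball (0 : ℂ) 3 := by
              rw [mem_ball_zero_iff] at hz ⊢
              have := norm_sub_norm_le z a
              rw [norm_sub_rev] at this
              linarith
            simp only [Set.indicator_of_mem hz, Set.indicator_of_mem hz3, sub_sub_cancel, le_refl]
          · simp only [Set.indicator_of_notMem hz, zero_le]
      _ ≤ M := by rw [hM]; gcongr; exact le_add_self

theorem lintegral_one_sub_norm_rpow_lt_top {β : ℝ} (hβ : β < 1) :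
    ∫⁻ z, ENNReal.ofReal (1 - ‖z‖) ^ (-β) ∂diskMeasure < ∞ := by
  apply lintegral_diskMeasure_lt_top
  have h1 : IntegrableOn (fun y : ℝ => (1 - y) ^ (-β)) (Set.Ioo 0 1) := by
    have := (intervalIntegral.intervalIntegrable_rpow' (a := 0) (b := 1)
      (show -1 < -β by linarith)).comp_sub_left 1
    simp only [sub_zero, sub_self] at this
    exact ((intervalIntegrable_iff_integrableOn_Ioo_of_le zero_le_one).1 this.symm)
  have h2 : IntegrableOn (fun z : ℂ => (1 - ‖z‖) ^ (-β)) (ball 0 1) := by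
    rw [integrableOn_fun_norm_addHaar volume (f := fun y : ℝ => (1 - y) ^ (-β))]
    refine Integrable.mono' h1 (by fun_prop) ?_
    filter_upwards [ae_restrict_mem measurableSet_Ioo] with y hy
    have : 0 ≤ (1 - y) ^ (-β) := Real.rpow_nonneg (by linarith [hy.2]) _
    simp only [Complex.finrank_real_complex, smul_eq_mul, norm_mul, Real.norm_eq_abs,
      abs_of_nonneg this]
    exact mul_le_of_le_one_left this (by simp [abs_of_pos hy.1, hy.2.le])
  refine lt_of_le_of_lt (lintegral_mono_ae ?_) h2.2
  filter_upwards [ae_restrict_mem measurableSet_ball] with z hz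
  have hz' : 0 < 1 - ‖z‖ := by linarith [mem_ball_zero_iff.1 hz]
  rw [Real.enorm_eq_ofReal (by positivity), ENNReal.ofReal_rpow_of_pos hz']

/-! ### Upper bound for the kernel -/

theorem norm_mul_conj_lt_one {z w : ℂ} (hz : z ∈ ball (0 : ℂ) 1) (hw : w ∈ ball (0 : ℂ) 1) :
    ‖z * conj w‖ < 1 := by
  rw [mem_ball_zero_iff] at hz hw
  rw [norm_mul, Complex.norm_conj]
  nlinarith [norm_nonneg z, norm_nonneg w]

theorem one_sub_smul_ne_zero {u : ℂ} (hu : ‖u‖ < 1) (r : unitInterval) :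
    1 - ((r : ℝ) : ℂ) * u ≠ 0 := by
  intro h
  have h1 : ‖((r : ℝ) : ℂ) * u‖ = 1 := by rw [← sub_eq_zero.1 h, norm_one]
  rw [norm_mul, Complex.norm_real, Real.norm_of_nonneg r.2.1] at h1
  nlinarith [r.2.1, r.2.2, norm_nonneg u]

theorem one_sub_le_norm_one_sub_smul {u : ℂ} (hu : ‖u‖ ≤ 1) (r : unitInterval) :
    1 - (r : ℝ) ≤ ‖1 - ((r : ℝ) : ℂ) * u‖ := by
  have h := norm_sub_norm_le (1 : ℂ) (((r : ℝ) : ℂ) * u)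
  rw [norm_mul, Complex.norm_real, Real.norm_of_nonneg r.2.1, norm_one] at h
  nlinarith [r.2.1, r.2.2, norm_nonneg u]

theorem norm_one_sub_le_two_mul {u : ℂ} (hu : ‖u‖ ≤ 1) (r : unitInterval) :
    ‖1 - u‖ ≤ 2 * ‖1 - ((r : ℝ) : ℂ) * u‖ := by
  have h1 := one_sub_le_norm_one_sub_smul hu r
  have h2 : 1 - u = (1 - ((r : ℝ) : ℂ) * u) - ((1 - r : ℝ) : ℂ) * u := by push_cast; ring
  have h3 : ‖((1 - r : ℝ) : ℂ) * u‖ ≤ 1 - r := by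
    rw [norm_mul, Complex.norm_real, Real.norm_of_nonneg (by linarith [r.2.2])]
    nlinarith [r.2.2, norm_nonneg u]
  calc ‖1 - u‖ ≤ ‖1 - ((r : ℝ) : ℂ) * u‖ + ‖((1 - r : ℝ) : ℂ) * u‖ := by
        rw [h2]; exact norm_sub_le _ _
    _ ≤ _ := by linarith

theorem enorm_one_div_one_sub_smul_le {u : ℂ} (hu : ‖u‖ < 1) (r : unitInterval) {a : ℝ}
    (h0 : 0 ≤ a) (h1 : a ≤ 1) :
    ‖1 / (1 - ((r : ℝ) : ℂ) * u)‖ₑ ≤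
      2 * ‖1 - u‖ₑ ^ (-(1 - a)) * (1 / ENNReal.ofReal (1 - (r : ℝ) ^ 2) ^ a) := by
  have hu1 : 1 - u ≠ 0 := by simpa using one_sub_smul_ne_zero hu 1
  set N := ‖1 - ((r : ℝ) : ℂ) * u‖ₑ with hN
  have hX : 2⁻¹ * ‖1 - u‖ₑ ≤ N := by
    rw [hN, ← ofReal_norm, ← ofReal_norm]
    calc (2 : ℝ≥0∞)⁻¹ * ENNReal.ofReal ‖1 - u‖ = ENNReal.ofReal (2⁻¹ * ‖1 - u‖) := by
          rw [ENNReal.ofReal_mul (by norm_num), ENNReal.ofReal_inv_of_pos two_pos]; simp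
      _ ≤ _ := ENNReal.ofReal_le_ofReal (by linarith [norm_one_sub_le_two_mul hu.le r])
  have hY : 2⁻¹ * ENNReal.ofReal (1 - (r : ℝ) ^ 2) ≤ N := by
    rw [hN, ← ofReal_norm]
    calc (2 : ℝ≥0∞)⁻¹ * ENNReal.ofReal (1 - (r : ℝ) ^ 2)
          = ENNReal.ofReal (2⁻¹ * (1 - (r : ℝ) ^ 2)) := by
          rw [ENNReal.ofReal_mul (by norm_num), ENNReal.ofReal_inv_of_pos two_pos]; simp
      _ ≤ _ := ENNReal.ofReal_le_ofReal (by
          nlinarith [one_sub_le_norm_one_sub_smul hu.le r, r.2.1, r.2.2])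
  -- Geometric mean of `hX` and `hY` with weights 1 - a and a.
  have key : 2⁻¹ * (‖1 - u‖ₑ ^ (1 - a) * ENNReal.ofReal (1 - (r : ℝ) ^ 2) ^ a) ≤ N := by
    calc 2⁻¹ * (‖1 - u‖ₑ ^ (1 - a) * ENNReal.ofReal (1 - (r : ℝ) ^ 2) ^ a)
        = (2⁻¹ * ‖1 - u‖ₑ) ^ (1 - a) * (2⁻¹ * ENNReal.ofReal (1 - (r : ℝ) ^ 2)) ^ a := by
          rw [ENNReal.mul_rpow_of_nonneg _ _ (by linarith), ENNReal.mul_rpow_of_nonneg _ _ h0,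
            mul_mul_mul_comm, ← ENNReal.rpow_add_of_nonneg _ _ (by linarith) h0]
          simp
      _ ≤ N ^ (1 - a) * N ^ a := by gcongr
      _ = N := by rw [← ENNReal.rpow_add_of_nonneg _ _ (by linarith) h0]; simp
  have hxt : ‖1 - u‖ₑ ^ (1 - a) ≠ ∞ := ENNReal.rpow_ne_top_of_nonneg (by linarith) (by simp)
  have hx0 : ‖1 - u‖ₑ ^ (1 - a) ≠ 0 := by
    refine (ENNReal.rpow_pos ?_ (by simp)).ne'
    simpa [pos_iff_ne_zero] using hu1
  calc ‖1 / (1 - ((r : ℝ) : ℂ) * u)‖ₑ = N⁻¹ := by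
        rw [one_div, enorm_inv (one_sub_smul_ne_zero hu r)]
    _ ≤ (2⁻¹ * (‖1 - u‖ₑ ^ (1 - a) * ENNReal.ofReal (1 - (r : ℝ) ^ 2) ^ a))⁻¹ :=
        ENNReal.inv_le_inv.2 key
    _ = _ := by
        rw [ENNReal.mul_inv (by simp) (by simp), inv_inv, ENNReal.mul_inv (.inl hx0) (.inl hxt),
          ENNReal.rpow_neg, one_div, mul_assoc]

/-- Integrability of (1 - r²)^(-a) buys a gain of a over the trivial exponent 2. The gain comes from
the inner integral, which contributes only |1 - z w̄|^(-(1-a)). -/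
theorem exists_enorm_kernel_le (ν : Measure unitInterval) {a : ℝ} (h0 : 0 ≤ a) (h1 : a ≤ 1)
    (h : ∫⁻ r : unitInterval, 1 / ENNReal.ofReal (1 - (r : ℝ) ^ 2) ^ a ∂ν < ∞) :
    ∃ C : ℝ≥0, ∀ z ∈ ball (0 : ℂ) 1, ∀ w ∈ ball (0 : ℂ) 1,
      ‖kernel ν z w‖ₑ ≤ C * ‖1 - z * conj w‖ₑ ^ (-(2 - a)) := by
  set I := ∫⁻ r : unitInterval, 1 / ENNReal.ofReal (1 - (r : ℝ) ^ 2) ^ a ∂ν with hI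
  refine ⟨(2 * I).toNNReal, fun z hz w hw => ?_⟩
  rw [ENNReal.coe_toNNReal (ENNReal.mul_ne_top (by simp) h.ne)]
  have hu := norm_mul_conj_lt_one hz hw
  have hu1 : 1 - z * conj w ≠ 0 := by simpa using one_sub_smul_ne_zero hu 1
  have hle : ‖∫ r : unitInterval, 1 / (1 - ((r : ℝ) : ℂ) * z * conj w) ∂ν‖ₑ ≤
      2 * ‖1 - z * conj w‖ₑ ^ (-(1 - a)) * I := by
    refine (enorm_integral_le_lintegral_enorm _).trans ?_
    rw [hI, ← lintegral_const_mul _ (by fun_prop)]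
    refine lintegral_mono fun r => ?_
    rw [mul_assoc (((r : ℝ) : ℂ))]
    exact enorm_one_div_one_sub_smul_le hu r h0 h1
  have hne : ‖1 - z * conj w‖ₑ ≠ 0 := by simpa using hu1
  calc ‖kernel ν z w‖ₑ ≤ ‖1 - z * conj w‖ₑ⁻¹ * (2 * ‖1 - z * conj w‖ₑ ^ (-(1 - a)) * I) := by
        rw [kernel, enorm_mul, one_div, enorm_inv hu1]
        gcongr
    _ = 2 * I * (‖1 - z * conj w‖ₑ ^ (-1 : ℝ) * ‖1 - z * conj w‖ₑ ^ (-(1 - a))) := by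
        rw [ENNReal.rpow_neg_one]; ring
    _ = _ := by
        rw [← ENNReal.rpow_add _ _ hne (by simp)]
        ring_nf

theorem stronglyMeasurable_kernel (ν : Measure unitInterval) [IsFiniteMeasure ν] :
    StronglyMeasurable fun x : ℂ × ℂ => kernel ν x.1 x.2 := by
  have h1 : Measurable fun x : ℂ × ℂ => 1 / (1 - x.1 * conj x.2) := by fun_prop
  have h2 : StronglyMeasurable fun x : (ℂ × ℂ) × unitInterval =>
      1 / (1 - ((x.2 : ℝ) : ℂ) * x.1.1 * conj x.1.2) := by
    apply Measurable.stronglyMeasurable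
    fun_prop
  exact h1.stronglyMeasurable.mul h2.integral_prod_right'

theorem aestronglyMeasurable_operator (ν : Measure unitInterval) [IsFiniteMeasure ν] {f : ℂ → ℂ}
    (hf : AEStronglyMeasurable f diskMeasure) :
    AEStronglyMeasurable (operator ν f) diskMeasure :=
  ((stronglyMeasurable_kernel ν).aestronglyMeasurable.mul hf.comp_snd).integral_prod_right'

/-! ### Boundedness of the positive power operators -/

/-- The positive operator with kernel `‖1 - z w̄‖ ^ (-b)`. -/
noncomputable def powerOperator (b : ℝ) (g : ℂ → ℝ≥0∞) (z : ℂ) : ℝ≥0∞ :=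
  ∫⁻ w, ‖1 - z * conj w‖ₑ ^ (-b) * g w ∂diskMeasure

/-- Boundedness of `powerOperator b` from `L^p` to `L^q` of the disk. -/
def IsPowerBounded (b : ℝ) (p q : ℝ≥0∞) : Prop :=
  ∃ C : ℝ≥0, ∀ g : ℂ → ℝ≥0∞, AEMeasurable g diskMeasure →
    eLpNorm (powerOperator b g) q diskMeasure ≤ C * eLpNorm g p diskMeasure

theorem measurable_enorm_one_sub_rpow (b : ℝ) :
    Measurable (Function.uncurry fun z w : ℂ => ‖1 - z * conj w‖ₑ ^ (-b)) := by
  unfold Function.uncurry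
  fun_prop

theorem aemeasurable_powerOperator (b : ℝ) {g : ℂ → ℝ≥0∞} (hg : AEMeasurable g diskMeasure) :
    AEMeasurable (powerOperator b g) diskMeasure :=
  ((measurable_enorm_one_sub_rpow b).aemeasurable.mul hg.comp_snd).lintegral_prod_right'

/-- The disk measure is a probability measure, so the L^p norms increase with p. -/
theorem IsPowerBounded.mono {b : ℝ} {p q p' q' : ℝ≥0∞} (h : IsPowerBounded b p q) (hp : p ≤ p')
    (hq : q' ≤ q) : IsPowerBounded b p' q' := by
  obtain ⟨C, hC⟩ := h
  refine ⟨C, fun g hg => ?_⟩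
  calc _ ≤ eLpNorm (powerOperator b g) q diskMeasure :=
        eLpNorm_le_eLpNorm_of_exponent_le hq (aemeasurable_powerOperator b hg).aestronglyMeasurable
    _ ≤ C * eLpNorm g p diskMeasure := hC g hg
    _ ≤ _ := by
      gcongr
      exact eLpNorm_le_eLpNorm_of_exponent_le hp hg.aestronglyMeasurable

theorem IsPowerBounded.isBoundedLpLq {ν : Measure unitInterval} [IsFiniteMeasure ν] {a : ℝ}
    (h0 : 0 ≤ a) (h1 : a ≤ 1)
    (hν : ∫⁻ r : unitInterval, 1 / ENNReal.ofReal (1 - (r : ℝ) ^ 2) ^ a ∂ν < ∞) {p q : ℝ≥0∞}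
    (h : IsPowerBounded (2 - a) p q) : IsBoundedLpLq ν p q := by
  obtain ⟨C, hC⟩ := h
  obtain ⟨K, hK⟩ := exists_enorm_kernel_le ν h0 h1 hν
  refine ⟨K * C, fun f hf => ?_⟩
  have hle : eLpNorm (operator ν f) q diskMeasure ≤ ↑(K * C) * eLpNorm f p diskMeasure := by
    calc eLpNorm (operator ν f) q diskMeasure
        ≤ K • eLpNorm (powerOperator (2 - a) fun w => ‖f w‖ₑ) q diskMeasure := by
          refine eLpNorm_le_nnreal_smul_eLpNorm_of_ae_le_mul' ?_ _
          filter_upwards [ae_diskMeasure_mem_ball] with z hz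
          refine (enorm_integral_le_lintegral_enorm _).trans ?_
          rw [enorm_eq_self, powerOperator, ← lintegral_const_mul'' _ (by
            refine AEMeasurable.mul ?_ hf.1.enorm
            fun_prop)]
          refine lintegral_mono_ae ?_
          filter_upwards [ae_diskMeasure_mem_ball] with w hw
          rw [enorm_mul, ← mul_assoc]
          gcongr
          exact hK z hz w hw
      _ ≤ K * (C * eLpNorm (fun w => ‖f w‖ₑ) p diskMeasure) := by
          rw [ENNReal.smul_def, smul_eq_mul]
          gcongr
          exact hC _ hf.1.enorm
      _ = _ := by rw [eLpNorm_enorm]; push_cast; ring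
  exact ⟨⟨aestronglyMeasurable_operator ν hf.1, hle.trans_lt (by
    have := hf.2; finiteness)⟩, hle⟩

theorem eLpNorm_ofReal_eq_lintegral {p : ℝ} (hp : 0 < p) (g : ℂ → ℝ≥0∞) (μ : Measure ℂ) :
    eLpNorm g (ENNReal.ofReal p) μ = (∫⁻ z, g z ^ p ∂μ) ^ (1 / p) := by
  rw [eLpNorm_eq_lintegral_rpow_enorm_toReal (by simpa using hp) (by simp),
    ENNReal.toReal_ofReal hp.le]
  rfl

theorem exists_lintegral_rpow_kernel_le {b c : ℝ} (hb : 0 ≤ b) (hc : 0 < c) (hbc : b * c < 2) :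
    ∃ A : ℝ≥0,
      (∀ w ∈ ball (0 : ℂ) 1, ∫⁻ z, (‖1 - z * conj w‖ₑ ^ (-b)) ^ c ∂diskMeasure ≤ A) ∧
      ∀ z ∈ ball (0 : ℂ) 1, ∫⁻ w, (‖1 - z * conj w‖ₑ ^ (-b)) ^ c ∂diskMeasure ≤ A := by
  obtain ⟨A, hA⟩ := exists_lintegral_enorm_one_sub_rpow_le (by positivity) hbc
  have h : ∀ z w : ℂ, (‖1 - z * conj w‖ₑ ^ (-b)) ^ c = ‖1 - z * conj w‖ₑ ^ (-(b * c)) := by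
    intro z w
    rw [← ENNReal.rpow_mul, neg_mul]
  simp only [h]
  refine ⟨A, hA, fun z hz => ?_⟩
  simp only [enorm_one_sub_mul_conj_comm z]
  exact hA z hz

theorem isPowerBounded_ofReal {b p q c : ℝ} (hb : 0 ≤ b) (hp : 1 ≤ p) (hpq : p ≤ q) (hc : 0 < c)
    (hpqc : c⁻¹ = 1 + q⁻¹ - p⁻¹) (hbc : b * c < 2) :
    IsPowerBounded b (ENNReal.ofReal p) (ENNReal.ofReal q) := by
  obtain ⟨A, hA₁, hA₂⟩ := exists_lintegral_rpow_kernel_le hb hc hbc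
  have hA : (A : ℝ≥0∞) ^ c⁻¹ ≠ ∞ := ENNReal.rpow_ne_top_of_nonneg (by positivity) (by simp)
  refine ⟨((A : ℝ≥0∞) ^ c⁻¹).toNNReal, fun g hg => ?_⟩
  rw [eLpNorm_ofReal_eq_lintegral (by linarith), eLpNorm_ofReal_eq_lintegral (by linarith),
    ENNReal.coe_toNNReal hA]
  exact lintegral_kernel_rpow_le (measurable_enorm_one_sub_rpow b) hp hpq hc hpqc
    (ae_diskMeasure_mem_ball.mono hA₁) (ae_diskMeasure_mem_ball.mono hA₂) hg

theorem isPowerBounded_ofReal_top {b p c : ℝ} (hb : 0 ≤ b) (hpc : p.HolderConjugate c)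
    (hbc : b * c < 2) : IsPowerBounded b (ENNReal.ofReal p) ∞ := by
  obtain ⟨A, -, hA₂⟩ := exists_lintegral_rpow_kernel_le hb hpc.symm.pos hbc
  have hA : (A : ℝ≥0∞) ^ (1 / c) ≠ ∞ :=
    ENNReal.rpow_ne_top_of_nonneg (by have := hpc.symm.pos; positivity) (by simp)
  refine ⟨((A : ℝ≥0∞) ^ (1 / c)).toNNReal, fun g hg => ?_⟩
  rw [eLpNorm_ofReal_eq_lintegral hpc.pos, ENNReal.coe_toNNReal hA, eLpNorm_exponent_top]
  refine essSup_le_of_ae_le _ ?_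
  filter_upwards [ae_diskMeasure_mem_ball] with z hz
  exact lintegral_kernel_le_of_conj (by fun_prop) hg hpc (hA₂ z hz)

/-- A loss in the exponents compensates for the failure of `‖1 - z w̄‖ ^ (-2)` to be integrable. -/
theorem isPowerBounded_two {p q : ℝ} (hq : 1 ≤ q) (hqp : q < p) :
    IsPowerBounded 2 (ENNReal.ofReal p) (ENNReal.ofReal q) := by
  have hq0 : 0 < q := by linarith
  have hp0 : 0 < p := by linarith
  have hinv : p⁻¹ < q⁻¹ := inv_strictAnti₀ hq0 hqp
  set s := (q⁻¹ - p⁻¹)⁻¹ with hs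
  have hs0 : 0 < s := inv_pos.2 (by linarith)
  -- Here 1/q = 1/p + 1/s. The weight (1 - |w|)^(-δ) lies in L^s because δ s ≤ 1/2, so
  -- multiplication by it maps L^p to L^q. The remaining kernel exponent 2 - δ is handled by Young's
  -- inequality with c = 1.
  set δ := min 1 (1 / (2 * s)) with hδ
  have hδ0 : 0 < δ := by positivity
  have hδ1 : δ ≤ 1 := min_le_left _ _
  have hδs : δ * s < 1 := by
    have : δ * s ≤ 1 / (2 * s) * s := by gcongr; exact min_le_right _ _
    have h2 : 1 / (2 * s) * s = 1 / 2 := by field_simp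
    linarith
  obtain ⟨C, hC⟩ := isPowerBounded_ofReal (b := 2 - δ) (p := q) (q := q) (c := 1) (by linarith) hq
    le_rfl one_pos (by simp) (by linarith)
  set W := (∫⁻ z, (ENNReal.ofReal (1 - ‖z‖) ^ (-δ)) ^ s ∂diskMeasure) ^ (1 / s) with hW
  have hWtop : W ≠ ∞ := by
    refine ENNReal.rpow_ne_top_of_nonneg (by positivity) ?_
    simp only [← ENNReal.rpow_mul, neg_mul]
    exact (lintegral_one_sub_norm_rpow_lt_top hδs).ne
  refine ⟨C * W.toNNReal, fun g hg => ?_⟩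
  have hmeas : AEMeasurable (fun w => g w * ENNReal.ofReal (1 - ‖w‖) ^ (-δ)) diskMeasure :=
    hg.mul (by fun_prop)
  calc eLpNorm (powerOperator 2 g) (ENNReal.ofReal q) diskMeasure
      ≤ eLpNorm (powerOperator (2 - δ) fun w => g w * ENNReal.ofReal (1 - ‖w‖) ^ (-δ))
          (ENNReal.ofReal q) diskMeasure := by
        refine eLpNorm_mono_enorm_ae ?_
        filter_upwards [ae_diskMeasure_mem_ball] with z hz
        rw [enorm_eq_self, enorm_eq_self, powerOperator, powerOperator]
        refine lintegral_mono_ae ?_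
        filter_upwards [ae_diskMeasure_mem_ball] with w hw
        have hne : ‖1 - z * conj w‖ₑ ≠ 0 := by
          simpa using one_sub_smul_ne_zero (norm_mul_conj_lt_one hz hw) 1
        have hle : ENNReal.ofReal (1 - ‖w‖) ≤ ‖1 - z * conj w‖ₑ := by
          rw [← ofReal_norm]
          exact ENNReal.ofReal_le_ofReal (one_sub_norm_le (mem_ball_zero_iff.1 hz).le)
        calc ‖1 - z * conj w‖ₑ ^ (-2 : ℝ) * g w
            = ‖1 - z * conj w‖ₑ ^ (-(2 - δ)) * (g w * ‖1 - z * conj w‖ₑ ^ (-δ)) := by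
              rw [mul_comm (g w), ← mul_assoc, ← ENNReal.rpow_add _ _ hne (by simp)]
              ring_nf
          _ ≤ _ := by
              gcongr _ * (_ * ?_)
              rw [ENNReal.rpow_neg, ENNReal.rpow_neg]
              exact ENNReal.inv_le_inv.2 (ENNReal.rpow_le_rpow hle hδ0.le)
    _ ≤ C * eLpNorm (fun w => g w * ENNReal.ofReal (1 - ‖w‖) ^ (-δ)) (ENNReal.ofReal q)
          diskMeasure := hC _ hmeas
    _ ≤ C * (eLpNorm g (ENNReal.ofReal p) diskMeasure * W) := by
        gcongr
        rw [eLpNorm_ofReal_eq_lintegral hq0, eLpNorm_ofReal_eq_lintegral hp0]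
        exact ENNReal.lintegral_Lp_mul_le_Lq_mul_Lr hq0 hqp (by simp [hs]) _ hg (by fun_prop)
    _ = _ := by
        push_cast
        rw [ENNReal.coe_toNNReal hWtop]
        ring

/-! ### Lower bound for the kernel near the boundary point 1 -/

theorem one_div_le_re_one_div {P : ℂ} {x : ℝ} (hx : 0 < x) (h : ‖P - x‖ ≤ x / 3) :
    1 / (4 * x) ≤ (1 / P).re := by
  have hre : |P.re - x| ≤ x / 3 := by
    simpa using (Complex.abs_re_le_norm (P - x)).trans h
  have hn : ‖P‖ ≤ 4 / 3 * x := by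
    calc ‖P‖ = ‖(P - x) + x‖ := by simp
      _ ≤ ‖P - x‖ + ‖(x : ℂ)‖ := norm_add_le _ _
      _ ≤ _ := by rw [Complex.norm_real, Real.norm_of_nonneg hx.le]; linarith
  have hre' : 2 / 3 * x ≤ P.re := by linarith [(abs_le.1 hre).1]
  have hP : 0 < ‖P‖ := lt_of_lt_of_le (by linarith) (Complex.re_le_norm P)
  rw [one_div P, Complex.inv_re, Complex.normSq_eq_norm_sq, div_le_div_iff₀ (by positivity)
    (by positivity)]
  nlinarith

theorem one_div_le_re_kernel_integrand {δ : ℝ} (hδ0 : 0 < δ) (hδ1 : δ ≤ 1) {u : ℂ}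
    (hu : ‖u - ((1 - δ) ^ 2 : ℝ)‖ ≤ δ / 8) (r : unitInterval) :
    1 / (16 * δ * (1 - r + δ)) ≤ (1 / (1 - u) * (1 / (1 - ((r : ℝ) : ℂ) * u))).re := by
  have hr0 := r.2.1
  have hr1 := r.2.2
  set e := u - ((1 - δ) ^ 2 : ℝ) with he
  have hue : u = ((1 - δ) ^ 2 : ℝ) + e := by rw [he]; ring
  set m : ℝ := 1 - (1 - δ) ^ 2 with hm
  set n : ℝ := 1 - r * (1 - δ) ^ 2 with hn
  have hsq : (1 - δ) ^ 2 ≤ 1 - δ := by nlinarith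
  have hmδ : δ ≤ m := by linarith
  have hmn : m ≤ n := by nlinarith [sq_nonneg (1 - δ)]
  -- The numbers m and n are the values of 1 - u and 1 - ru at the centre u = (1 - δ)², so the
  -- denominator is a small complex perturbation of mn > 0. The relative error is at most 1/8 + 1/8
  -- + 1/64 < 1/3.
  have hm2 : m ≤ 2 * δ := by nlinarith
  have hn2 : n ≤ 2 * (1 - r + δ) := by nlinarith [sq_nonneg (1 - δ)]
  have hm0 : 0 < m := by linarith
  have hn0 : 0 < n := by linarith
  have hP : ‖(1 - u) * (1 - ((r : ℝ) : ℂ) * u) - ((m * n : ℝ) : ℂ)‖ ≤ m * n / 3 := by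
    have h1 : (1 - u) * (1 - ((r : ℝ) : ℂ) * u) - ((m * n : ℝ) : ℂ) =
        -(n : ℂ) * e - (m : ℂ) * ((r : ℝ) : ℂ) * e + ((r : ℝ) : ℂ) * e * e := by
      rw [hue, hm, hn]; push_cast; ring
    have hnr : ‖((r : ℝ) : ℂ)‖ ≤ 1 := by
      rw [Complex.norm_real, Real.norm_of_nonneg hr0]; exact hr1
    have hnm : ‖(m : ℂ)‖ = m := by rw [Complex.norm_real, Real.norm_of_nonneg hm0.le]
    have hnn : ‖(n : ℂ)‖ = n := by rw [Complex.norm_real, Real.norm_of_nonneg hn0.le]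
    have hem : ‖e‖ ≤ m / 8 := by linarith
    have hen : ‖e‖ ≤ n / 8 := by linarith
    have hre : ‖((r : ℝ) : ℂ)‖ * ‖e‖ ≤ n / 8 := by
      nlinarith [norm_nonneg e, norm_nonneg ((r : ℝ) : ℂ)]
    rw [h1]
    calc _ ≤ ‖-(n : ℂ) * e‖ + ‖(m : ℂ) * ((r : ℝ) : ℂ) * e‖ + ‖((r : ℝ) : ℂ) * e * e‖ :=
          (norm_add_le _ _).trans (by gcongr; exact norm_sub_le _ _)
      _ = n * ‖e‖ + m * (‖((r : ℝ) : ℂ)‖ * ‖e‖) + (‖((r : ℝ) : ℂ)‖ * ‖e‖) * ‖e‖ := by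
          simp only [norm_mul, norm_neg, hnm, hnn]; ring
      _ ≤ n * (m / 8) + m * (n / 8) + n / 8 * (m / 8) := by gcongr
      _ ≤ _ := by nlinarith [mul_pos hm0 hn0]
  calc 1 / (16 * δ * (1 - r + δ)) ≤ 1 / (4 * (m * n)) := by
        refine one_div_le_one_div_of_le (by positivity) ?_
        nlinarith [mul_le_mul hm2 hn2 hn0.le (by linarith)]
    _ ≤ _ := by
        rw [one_div_mul_one_div]
        exact one_div_le_re_one_div (mul_pos hm0 hn0) hP

theorem integrable_of_continuous_unitInterval {E : Type*} [NormedAddCommGroup E]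
    (ν : Measure unitInterval) [IsFiniteMeasure ν] {f : unitInterval → E} (hf : Continuous f) :
    Integrable f ν :=
  hf.integrable_of_hasCompactSupport (HasCompactSupport.of_compactSpace f)

theorem integrable_one_div_one_sub_add (ν : Measure unitInterval) [IsFiniteMeasure ν] {δ : ℝ}
    (hδ : 0 < δ) : Integrable (fun r : unitInterval => 1 / (1 - (r : ℝ) + δ)) ν := by
  apply integrable_of_continuous_unitInterval
  refine Continuous.div continuous_const (by fun_prop) fun r => ?_
  linarith [r.2.2]

theorem le_re_kernel (ν : Measure unitInterval) [IsFiniteMeasure ν] {δ : ℝ} (hδ0 : 0 < δ)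
    (hδ1 : δ ≤ 1) {z w : ℂ} (hz : z ∈ ball ((1 - δ : ℝ) : ℂ) (δ / 24))
    (hw : w ∈ ball ((1 - δ : ℝ) : ℂ) (δ / 24)) :
    1 / (16 * δ) * ∫ r : unitInterval, 1 / (1 - (r : ℝ) + δ) ∂ν ≤ (kernel ν z w).re := by
  have hball : ∀ {x : ℂ}, x ∈ ball ((1 - δ : ℝ) : ℂ) (δ / 24) → ‖x - (1 - δ : ℝ)‖ < δ / 24 :=
    fun hx => mem_ball_iff_norm.1 hx
  have hnr : ‖((1 - δ : ℝ) : ℂ)‖ ≤ 1 := by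
    rw [Complex.norm_real, Real.norm_of_nonneg (by linarith)]; linarith
  -- The radius δ/24 is chosen so that the two linear terms and the product term together contribute
  -- at most 3 · δ/24.
  have hu : ‖z * conj w - ((1 - δ) ^ 2 : ℝ)‖ ≤ δ / 8 := by
    set a := z - (1 - δ : ℝ) with ha
    set b := w - (1 - δ : ℝ) with hb
    have ha' : ‖a‖ ≤ δ / 24 := (hball hz).le
    have hb' : ‖conj b‖ ≤ δ / 24 := by rw [Complex.norm_conj]; exact (hball hw).le
    have h1 : z * conj w - ((1 - δ) ^ 2 : ℝ) =
        ((1 - δ : ℝ) : ℂ) * (a + conj b) + a * conj b := by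
      rw [ha, hb, map_sub, Complex.conj_ofReal]; push_cast; ring
    rw [h1]
    calc _ ≤ ‖((1 - δ : ℝ) : ℂ)‖ * (‖a‖ + ‖conj b‖) + ‖a‖ * ‖conj b‖ := by
          refine (norm_add_le _ _).trans ?_
          rw [norm_mul, norm_mul]
          gcongr
          exact norm_add_le _ _
      _ ≤ 1 * (δ / 24 + δ / 24) + δ / 24 * 1 := by
          gcongr
          linarith
      _ = δ / 8 := by ring
  have hnu : ‖z * conj w‖ < 1 := by
    have h1 : ‖z * conj w‖ ≤ ‖z * conj w - ((1 - δ) ^ 2 : ℝ)‖ + ‖(((1 - δ) ^ 2 : ℝ) : ℂ)‖ := by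
      have := norm_add_le (z * conj w - ((1 - δ) ^ 2 : ℝ)) (((1 - δ) ^ 2 : ℝ) : ℂ)
      rwa [sub_add_cancel] at this
    rw [Complex.norm_real, Real.norm_of_nonneg (sq_nonneg _)] at h1
    nlinarith
  set u := z * conj w with hu_def
  have hint : Integrable (fun r : unitInterval =>
      1 / (1 - u) * (1 / (1 - ((r : ℝ) : ℂ) * u))) ν := by
    apply integrable_of_continuous_unitInterval
    refine continuous_const.mul ?_
    exact Continuous.div continuous_const (by fun_prop) fun r => one_sub_smul_ne_zero hnu r
  have hk : kernel ν z w = ∫ r : unitInterval, 1 / (1 - u) * (1 / (1 - ((r : ℝ) : ℂ) * u)) ∂ν := by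
    rw [integral_const_mul, kernel]
    simp only [mul_assoc, hu_def]
  rw [hk, ← integral_const_mul]
  change _ ≤ Complex.reCLM _
  rw [← ContinuousLinearMap.integral_comp_comm _ hint]
  refine integral_mono ((integrable_one_div_one_sub_add ν hδ0).const_mul _)
    (Complex.reCLM.integrable_comp hint) fun r => ?_
  refine le_trans (le_of_eq ?_) (one_div_le_re_kernel_integrand hδ0 hδ1 hu r)
  rw [one_div_mul_one_div]

/-! ### Necessary conditions from testing on small disks -/

/-- For fixed z in the disk the kernel is bounded by a multiple of (1 - |z|)⁻². This lets the real
part pass through the integral in the test. -/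
theorem integrable_kernel (ν : Measure unitInterval) [IsFiniteMeasure ν] {z : ℂ}
    (hz : z ∈ ball (0 : ℂ) 1) : Integrable (kernel ν z) diskMeasure := by
  have hfin : ∫⁻ r : unitInterval, 1 / ENNReal.ofReal (1 - (r : ℝ) ^ 2) ^ (0 : ℝ) ∂ν < ∞ := by
    simp
  obtain ⟨C, hC⟩ := exists_enorm_kernel_le ν le_rfl zero_le_one hfin
  obtain ⟨A, -, hA⟩ := exists_lintegral_rpow_kernel_le (b := 1) (c := 1) zero_le_one one_pos
    (by norm_num)
  have hz' : 0 < 1 - ‖z‖ := by linarith [mem_ball_zero_iff.1 hz]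
  have hmeas : AEStronglyMeasurable (kernel ν z) diskMeasure :=
    ((stronglyMeasurable_kernel ν).comp_measurable
      (measurable_prodMk_left (x := z))).aestronglyMeasurable
  set M : ℝ≥0∞ := C * ENNReal.ofReal (1 - ‖z‖) ^ (-2 : ℝ) with hM
  have hMtop : M ≠ ∞ := by
    have h0 : ENNReal.ofReal (1 - ‖z‖) ≠ 0 := by simpa using hz'
    have := ENNReal.rpow_ne_top_of_ne_zero (y := -2) h0 ENNReal.ofReal_ne_top
    finiteness
  refine Integrable.of_bound hmeas M.toReal ?_
  filter_upwards [ae_diskMeasure_mem_ball] with w hw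
  rw [← toReal_enorm]
  refine ENNReal.toReal_mono hMtop ((hC z hz w hw).trans ?_)
  rw [hM, sub_zero, ENNReal.rpow_neg, ENNReal.rpow_neg]
  gcongr
  rw [← ofReal_norm, norm_one_sub_mul_conj_comm]
  exact ENNReal.ofReal_le_ofReal (one_sub_norm_le (mem_ball_zero_iff.1 hw).le)

theorem diskMeasure_ball {x : ℂ} {t : ℝ} (ht : 0 ≤ t) (h : ball x t ⊆ ball 0 1) :
    diskMeasure (ball x t) = ENNReal.ofReal (t ^ 2) := by
  have hπ : ENNReal.ofReal Real.pi ≠ 0 := by simp [Real.pi_pos]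
  have hπ' : ((NNReal.pi : ℝ≥0) : ℝ≥0∞) = ENNReal.ofReal Real.pi := by
    simp [← NNReal.coe_real_pi]
  rw [diskMeasure, Measure.smul_apply, Measure.restrict_apply measurableSet_ball,
    Set.inter_eq_self_of_subset_left h, Complex.volume_ball, hπ', smul_eq_mul, mul_left_comm,
    ENNReal.inv_mul_cancel hπ (by simp), mul_one, ENNReal.ofReal_pow ht]

/-- Testing the boundedness of `T_ν` on the indicator functions of small disks near the boundary. -/
theorem IsBoundedLpLq.exists_mul_integral_le {ν : Measure unitInterval} [IsFiniteMeasure ν]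
    {p q : ℝ≥0∞} (hp : p ≠ 0) (hq : q ≠ 0) (h : IsBoundedLpLq ν p q) :
    ∃ C : ℝ, 0 ≤ C ∧ ∀ δ : ℝ, 0 < δ → δ ≤ 1 →
      δ * ∫ r : unitInterval, 1 / (1 - (r : ℝ) + δ) ∂ν ≤
        C * δ ^ (2 * ((1 / p).toReal - (1 / q).toReal)) := by
  obtain ⟨K, hK⟩ := h
  set x := (1 / p).toReal with hx
  set y := (1 / q).toReal with hy
  have hxp : 1 / p.toReal = x := by simp [hx]
  have hyq : 1 / q.toReal = y := by simp [hy]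
  refine ⟨16 * 24 ^ 2 * K * (1 / 24) ^ (2 * (x - y)), by positivity, fun δ hδ0 hδ1 => ?_⟩
  set Φ := ∫ r : unitInterval, 1 / (1 - (r : ℝ) + δ) ∂ν with hΦ
  have hΦ0 : 0 ≤ Φ := integral_nonneg fun r => by
    have := r.2.2
    exact one_div_nonneg.2 (by linarith)
  set t := δ / 24 with ht
  have ht0 : 0 < t := by positivity
  set B := ball ((1 - δ : ℝ) : ℂ) t with hB
  have hBsub : B ⊆ ball 0 1 := by
    apply ball_subset_ball'
    rw [dist_zero_right, Complex.norm_real, Real.norm_of_nonneg (by linarith)]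
    linarith
  have hμB : diskMeasure B = ENNReal.ofReal (t ^ 2) := diskMeasure_ball ht0.le hBsub
  have hμB0 : diskMeasure B ≠ 0 := by rw [hμB]; simp; positivity
  have hBmeas : MeasurableSet B := measurableSet_ball
  set f : ℂ → ℂ := B.indicator fun _ => 1 with hf
  have hfmem : MemLp f p diskMeasure :=
    memLp_indicator_const p hBmeas 1 (.inr (measure_ne_top _ _))
  have hfnorm : eLpNorm f p diskMeasure = ENNReal.ofReal (t ^ (2 * x)) := by
    rw [hf, eLpNorm_indicator_const' hBmeas hμB0 hp, hμB, hxp, enorm_one, one_mul,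
      ENNReal.ofReal_rpow_of_pos (by positivity), ← Real.rpow_natCast, ← Real.rpow_mul ht0.le]
    simp
  set m : ℝ := 1 / (16 * δ) * Φ * t ^ 2 with hm
  have hm0 : 0 ≤ m := by positivity
  -- Pointwise lower bound for the kernel on B × B, times the measure t² of B.
  have hlow : ∀ z ∈ B, m ≤ ‖operator ν f z‖ := by
    intro z hz
    refine le_trans ?_ (Complex.re_le_norm _)
    have hop : operator ν f z = ∫ w in B, kernel ν z w ∂diskMeasure := by
      rw [operator, ← integral_indicator hBmeas]
      congr 1 with w
      by_cases hw : w ∈ B <;> simp [hf, hw]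
    have hint : Integrable (kernel ν z) (diskMeasure.restrict B) :=
      (integrable_kernel ν (hBsub hz)).restrict
    rw [hop]
    change _ ≤ Complex.reCLM _
    rw [← ContinuousLinearMap.integral_comp_comm _ hint]
    have h1 : ∫ w in B, 1 / (16 * δ) * Φ ∂diskMeasure = m := by
      rw [setIntegral_const, measureReal_def, hμB, ENNReal.toReal_ofReal (by positivity),
        smul_eq_mul, mul_comm, hm]
    rw [← h1]
    refine setIntegral_mono_on (integrable_const _) (Complex.reCLM.integrable_comp hint) hBmeas
      fun w hw => ?_
    exact le_re_kernel ν hδ0 hδ1 hz hw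
  have hTnorm : ENNReal.ofReal (m * t ^ (2 * y)) ≤ eLpNorm (operator ν f) q diskMeasure := by
    calc ENNReal.ofReal (m * t ^ (2 * y))
        = eLpNorm (B.indicator fun _ => m) q diskMeasure := by
          rw [eLpNorm_indicator_const' hBmeas hμB0 hq, hμB, hyq,
            ENNReal.ofReal_rpow_of_pos (by positivity), ← Real.rpow_natCast,
            ← Real.rpow_mul ht0.le, Real.enorm_eq_ofReal hm0, ← ENNReal.ofReal_mul hm0]
          simp
      _ ≤ _ := by
          refine eLpNorm_mono fun z => ?_
          by_cases hz : z ∈ B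
          · simpa [hz, abs_of_nonneg hm0] using hlow z hz
          · simp [hz]
  have hfin := hTnorm.trans (hK f hfmem).2
  rw [hfnorm, ← ENNReal.ofReal_coe_nnreal, ← ENNReal.ofReal_mul (by positivity),
    ENNReal.ofReal_le_ofReal_iff (by positivity)] at hfin
  have hm' : m = (δ * Φ) / (16 * 24 ^ 2) := by
    rw [hm, ht]; field_simp
  have hty : 0 < t ^ (2 * y) := by positivity
  have h2 : m ≤ K * t ^ (2 * (x - y)) := by
    rw [mul_sub, Real.rpow_sub ht0, ← mul_div_assoc, le_div_iff₀ hty]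
    exact hfin
  have h3 : t ^ (2 * (x - y)) = (1 / 24) ^ (2 * (x - y)) * δ ^ (2 * (x - y)) := by
    rw [← Real.mul_rpow (by positivity) hδ0.le, ht]; congr 1; ring
  rw [hm', h3, div_le_iff₀ (by positivity)] at h2
  calc δ * Φ ≤ _ := h2
    _ = _ := by ring

/-- Since 1 - r + δ ≤ 2, the tested integral stays above ν([0,1])/2 > 0 as δ → 0, so the power of δ
on the right cannot exceed 1. This covers the range not seen by `criticalIndex`, whose supremum is
restricted to c < 2. -/
theorem IsBoundedLpLq.inv_sub_inv_le_half {ν : Measure unitInterval} [IsFiniteMeasure ν]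
    (hν : ν ≠ 0) {p q : ℝ≥0∞} (hp : p ≠ 0) (hq : q ≠ 0) (h : IsBoundedLpLq ν p q) :
    (1 / p).toReal - (1 / q).toReal ≤ 1 / 2 := by
  obtain ⟨C, hC0, hC⟩ := h.exists_mul_integral_le hp hq
  by_contra! hlt
  set e := 2 * ((1 / p).toReal - (1 / q).toReal) - 1 with he
  have he0 : 0 < e := by linarith
  have hpos : 0 < ν.real Set.univ := by
    rw [measureReal_def, ENNReal.toReal_pos_iff]
    exact ⟨by simpa [pos_iff_ne_zero] using hν, measure_lt_top _ _⟩
  have hle : ∀ δ : ℝ, 0 < δ → δ ≤ 1 → ν.real Set.univ / 2 ≤ C * δ ^ e := by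
    intro δ h0 h1
    have h2 : ν.real Set.univ / 2 ≤ ∫ r : unitInterval, 1 / (1 - (r : ℝ) + δ) ∂ν := by
      calc ν.real Set.univ / 2 = ∫ _ : unitInterval, (1 / 2 : ℝ) ∂ν := by
            rw [integral_const, smul_eq_mul]; ring
        _ ≤ _ := by
            refine integral_mono (integrable_const _) (integrable_one_div_one_sub_add ν h0)
              fun r => ?_
            have := r.2.1
            have := r.2.2
            exact one_div_le_one_div_of_le (by linarith) (by linarith)
    have h3 := hC δ h0 h1
    have h4 : δ ^ (2 * ((1 / p).toReal - (1 / q).toReal)) = δ * δ ^ e := by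
      rw [he, Real.rpow_sub_one h0.ne']; field_simp
    rw [h4, mul_left_comm] at h3
    exact h2.trans (le_of_mul_le_mul_left h3 h0)
  have htend : Filter.Tendsto (fun n : ℕ => C * ((1 / 2 : ℝ) ^ n) ^ e) Filter.atTop
      (nhds (C * 0 ^ e)) :=
    ((tendsto_pow_atTop_nhds_zero_of_lt_one (by norm_num) (by norm_num)).rpow_const
      (.inr he0.le)).const_mul C
  rw [Real.zero_rpow he0.ne', mul_zero] at htend
  have := ge_of_tendsto' htend fun n =>
    hle ((1 / 2 : ℝ) ^ n) (by positivity) (pow_le_one₀ (by norm_num) (by norm_num))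
  linarith

theorem one_div_rpow_le_tsum {a : ℝ} (ha : 0 ≤ a) (r : unitInterval) :
    1 / ENNReal.ofReal (1 - (r : ℝ) ^ 2) ^ a ≤
      ∑' n : ℕ, {s : unitInterval | 1 - (s : ℝ) ≤ (1 / 2) ^ n}.indicator
        (fun _ => ENNReal.ofReal ((2 ^ (n + 1)) ^ a)) r := by
  rcases r.2.2.eq_or_lt with hr | hr
  · have htop : ∑' n : ℕ, {s : unitInterval | 1 - (s : ℝ) ≤ (1 / 2) ^ n}.indicator
        (fun _ => ENNReal.ofReal ((2 ^ (n + 1)) ^ a)) r = ∞ := by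
      rw [eq_top_iff, ← ENNReal.tsum_const_eq_top_of_ne_zero (α := ℕ) one_ne_zero]
      refine ENNReal.tsum_le_tsum fun n => ?_
      rw [Set.indicator_of_mem (by simp [hr]), ENNReal.one_le_ofReal]
      exact Real.one_le_rpow (one_le_pow₀ one_le_two) ha
    rw [htop]
    exact le_top
  · obtain ⟨n, hn1, hn2⟩ := exists_nat_pow_near_of_lt_one (x := 1 - (r : ℝ)) (y := 1 / 2)
      (by linarith) (by linarith [r.2.1]) (by norm_num) (by norm_num)
    refine le_trans ?_ (ENNReal.le_tsum n)
    rw [Set.indicator_of_mem (by exact hn2)]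
    have hpos : (0 : ℝ) < (1 / 2) ^ (n + 1) := by positivity
    have hle : (1 / 2 : ℝ) ^ (n + 1) ≤ 1 - (r : ℝ) ^ 2 := by nlinarith [r.2.1]
    have hinv : (2 ^ (n + 1) : ℝ) = ((1 / 2) ^ (n + 1))⁻¹ := by simp
    rw [hinv, Real.inv_rpow hpos.le, ENNReal.ofReal_inv_of_pos (by positivity),
      ← ENNReal.ofReal_rpow_of_pos hpos, one_div]
    gcongr

/-- Markov's inequality turns the test into the tail bound ν{1 - r ≤ δ} ≤ 2C δ^(2(x-y)), with x =
1/p and y = 1/q. Weighted by 2^((n+1)a) over δ = 2^(-n), these tails form a convergent geometric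
series. -/
theorem IsBoundedLpLq.lintegral_lt_top {ν : Measure unitInterval} [IsFiniteMeasure ν]
    {p q : ℝ≥0∞} (hp : p ≠ 0) (hq : q ≠ 0) (h : IsBoundedLpLq ν p q) {a : ℝ} (ha : 0 ≤ a)
    (hlt : a < 2 * ((1 / p).toReal - (1 / q).toReal)) :
    ∫⁻ r : unitInterval, 1 / ENNReal.ofReal (1 - (r : ℝ) ^ 2) ^ a ∂ν < ∞ := by
  obtain ⟨C, hC0, hC⟩ := h.exists_mul_integral_le hp hq
  set s := 2 * ((1 / p).toReal - (1 / q).toReal) with hs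
  have htail : ∀ δ : ℝ, 0 < δ → δ ≤ 1 →
      ν {s : unitInterval | 1 - (s : ℝ) ≤ δ} ≤ ENNReal.ofReal (2 * C * δ ^ s) := by
    intro δ h0 h1
    have hmar := mul_meas_ge_le_integral_of_nonneg (μ := ν)
      (f := fun r : unitInterval => 1 / (1 - (r : ℝ) + δ))
      (ae_of_all _ fun r => one_div_nonneg.2 (by linarith [r.2.2]))
      (integrable_one_div_one_sub_add ν h0) (1 / (2 * δ))
    have hsub : {s : unitInterval | 1 - (s : ℝ) ≤ δ} ⊆
        {r : unitInterval | 1 / (2 * δ) ≤ 1 / (1 - (r : ℝ) + δ)} := by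
      intro r hr
      have hr' : 1 - (r : ℝ) ≤ δ := hr
      have hr1 := r.2.2
      change 1 / (2 * δ) ≤ 1 / (1 - (r : ℝ) + δ)
      exact one_div_le_one_div_of_le (by linarith) (by linarith)
    rw [← ofReal_measureReal]
    refine ENNReal.ofReal_le_ofReal ((measureReal_mono hsub).trans ?_)
    have h2 := hC δ h0 h1
    rw [one_div_mul_eq_div, div_le_iff₀' (by positivity)] at hmar
    calc _ ≤ 2 * δ * ∫ r : unitInterval, 1 / (1 - (r : ℝ) + δ) ∂ν := hmar
      _ = 2 * (δ * ∫ r : unitInterval, 1 / (1 - (r : ℝ) + δ) ∂ν) := by ring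
      _ ≤ 2 * (C * δ ^ s) := by gcongr
      _ = _ := by ring
  have hterm : ∀ n : ℕ, ((2 : ℝ) ^ (n + 1)) ^ a * (2 * C * ((1 / 2 : ℝ) ^ n) ^ s) =
      2 ^ a * (2 * C) * (2 ^ (a - s)) ^ n := by
    intro n
    have h1 : ((2 : ℝ) ^ (n + 1)) ^ a = 2 ^ a * (2 ^ a) ^ n := by
      rw [pow_succ, Real.mul_rpow (by positivity) (by positivity), ← Real.rpow_natCast,
        ← Real.rpow_natCast, ← Real.rpow_mul (by norm_num), ← Real.rpow_mul (by norm_num),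
        mul_comm a, mul_comm]
    have h2 : ((1 / 2 : ℝ) ^ n) ^ s = ((2 ^ s)⁻¹) ^ n := by
      rw [one_div, inv_pow, inv_pow, Real.inv_rpow (by positivity), ← Real.rpow_natCast,
        ← Real.rpow_natCast, ← Real.rpow_mul (by norm_num), ← Real.rpow_mul (by norm_num),
        mul_comm s]
    rw [h1, h2, Real.rpow_sub two_pos, div_eq_mul_inv, mul_pow]
    ring
  have hsum : Summable fun n : ℕ => (2 : ℝ) ^ a * (2 * C) * (2 ^ (a - s)) ^ n :=
    (summable_geometric_of_lt_one (by positivity)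
      (Real.rpow_lt_one_of_one_lt_of_neg one_lt_two (by linarith))).mul_left _
  have hset : ∀ n : ℕ, MeasurableSet {s : unitInterval | 1 - (s : ℝ) ≤ (1 / 2) ^ n} := fun n =>
    measurableSet_le (by fun_prop) measurable_const
  calc _ ≤ ∫⁻ r : unitInterval, ∑' n : ℕ,
        {s : unitInterval | 1 - (s : ℝ) ≤ (1 / 2) ^ n}.indicator
          (fun _ => ENNReal.ofReal ((2 ^ (n + 1)) ^ a)) r ∂ν :=
        lintegral_mono (one_div_rpow_le_tsum ha)
    _ = ∑' n : ℕ, ENNReal.ofReal ((2 ^ (n + 1)) ^ a) *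
          ν {s : unitInterval | 1 - (s : ℝ) ≤ (1 / 2) ^ n} := by
        rw [lintegral_tsum fun n => (measurable_const.indicator (hset n)).aemeasurable]
        simp only [lintegral_indicator_const (hset _)]
    _ ≤ ∑' n : ℕ, ENNReal.ofReal (2 ^ a * (2 * C) * (2 ^ (a - s)) ^ n) := by
        refine ENNReal.tsum_le_tsum fun n => ?_
        rw [← hterm, ENNReal.ofReal_mul (by positivity)]
        gcongr
        exact htail _ (by positivity) (pow_le_one₀ (by norm_num) (by norm_num))
    _ < ∞ := hsum.tsum_ofReal_lt_top

/-! ### Reciprocal exponents and the critical index -/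

theorem toReal_one_div_le_iff {p q : ℝ≥0∞} (hp : 1 ≤ p) (hq : 1 ≤ q) :
    (1 / p).toReal ≤ (1 / q).toReal ↔ q ≤ p := by
  have hp' : 1 / p ≠ ∞ := by simpa using (zero_lt_one.trans_le hp).ne'
  have hq' : 1 / q ≠ ∞ := by simpa using (zero_lt_one.trans_le hq).ne'
  rw [ENNReal.toReal_le_toReal hp' hq', one_div, one_div, ENNReal.inv_le_inv]

theorem toReal_one_div_lt_iff {p q : ℝ≥0∞} (hp : 1 ≤ p) (hq : 1 ≤ q) :
    (1 / p).toReal < (1 / q).toReal ↔ q < p := by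
  rw [← not_le, toReal_one_div_le_iff hq hp, not_le]

theorem toReal_one_div_inj {p q : ℝ≥0∞} (hp : 1 ≤ p) (hq : 1 ≤ q) :
    (1 / p).toReal = (1 / q).toReal ↔ p = q := by
  rw [le_antisymm_iff, toReal_one_div_le_iff hp hq, toReal_one_div_le_iff hq hp,
    le_antisymm_iff, and_comm]

theorem toReal_one_div_le_one {p : ℝ≥0∞} (hp : 1 ≤ p) : (1 / p).toReal ≤ 1 := by
  simpa using (toReal_one_div_le_iff hp le_rfl).2 hp

theorem toReal_one_div_conjExponent {c : ℝ≥0∞} (hc : 1 ≤ c) :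
    (1 / c.conjExponent).toReal = 1 - (1 / c).toReal := by
  have h : c⁻¹ + (c.conjExponent)⁻¹ = 1 := by
    have := ENNReal.HolderConjugate.conjExponent hc
    exact ENNReal.HolderConjugate.inv_add_inv_eq_one c c.conjExponent
  have h1 : c⁻¹ ≠ ∞ := fun h' => by simp [h'] at h
  have h2 : (c.conjExponent)⁻¹ ≠ ∞ := fun h' => by simp [h'] at h
  rw [one_div, one_div, eq_sub_iff_add_eq', ← ENNReal.toReal_add h1 h2, h, ENNReal.toReal_one]

theorem one_le_conjExponent (c : ℝ≥0∞) : 1 ≤ c.conjExponent := le_self_add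

theorem toReal_two_div_conjExponent {c : ℝ≥0∞} (hc : 1 ≤ c) :
    (2 / c.conjExponent).toReal = 2 * (1 - (1 / c).toReal) := by
  rw [← toReal_one_div_conjExponent hc, div_eq_mul_one_div, ENNReal.toReal_mul]
  rfl

theorem toReal_one_div_ofReal_inv {t : ℝ} (ht : 0 < t) :
    (1 / ENNReal.ofReal t⁻¹).toReal = t := by
  rw [one_div, ENNReal.ofReal_inv_of_pos ht, inv_inv, ENNReal.toReal_ofReal ht.le]

theorem one_le_ofReal_inv {t : ℝ} (ht : 0 < t) (ht1 : t ≤ 1) : 1 ≤ ENNReal.ofReal t⁻¹ := by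
  rw [ENNReal.one_le_ofReal]
  exact (one_le_inv₀ ht).2 ht1

theorem ofReal_inv_le {p : ℝ≥0∞} {x : ℝ} (hp : 1 ≤ p) (hx : 0 < x) (hx1 : x ≤ 1)
    (h : (1 / p).toReal ≤ x) : ENNReal.ofReal x⁻¹ ≤ p := by
  rwa [← toReal_one_div_le_iff hp (one_le_ofReal_inv hx hx1), toReal_one_div_ofReal_inv hx]

theorem le_ofReal_inv {p : ℝ≥0∞} {x : ℝ} (hp : 1 ≤ p) (hx : 0 < x) (hx1 : x ≤ 1)
    (h : x ≤ (1 / p).toReal) : p ≤ ENNReal.ofReal x⁻¹ := by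
  rwa [← toReal_one_div_le_iff (one_le_ofReal_inv hx hx1) hp, toReal_one_div_ofReal_inv hx]

theorem criticalIndex_le_two (ν : Measure unitInterval) : criticalIndex ν ≤ 2 :=
  sSup_le fun _ hc => hc.2.1.le

theorem one_le_criticalIndex (ν : Measure unitInterval) [IsFiniteMeasure ν] :
    1 ≤ criticalIndex ν := by
  refine le_sSup ⟨le_rfl, by norm_num, ?_⟩
  rw [toReal_two_div_conjExponent le_rfl]
  simp

/-- Every `t > 1 / c_ν` has an admissible exponent `1 / c < t` below it. -/
theorem exists_lintegral_lt_top_of_lt (ν : Measure unitInterval) [IsFiniteMeasure ν] {t : ℝ}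
    (ht1 : t ≤ 1) (ht : (1 / criticalIndex ν).toReal < t) :
    ∃ s : ℝ, 0 ≤ s ∧ s < t ∧ 1 / 2 ≤ s ∧ s ≤ 1 ∧
      ∫⁻ r : unitInterval, 1 / ENNReal.ofReal (1 - (r : ℝ) ^ 2) ^ (2 * (1 - s)) ∂ν < ∞ := by
  have ht0 : 0 < t := ENNReal.toReal_nonneg.trans_lt ht
  have h1 := one_le_ofReal_inv ht0 ht1
  have hlt : ENNReal.ofReal t⁻¹ < criticalIndex ν := by
    rwa [← toReal_one_div_lt_iff (one_le_criticalIndex ν) h1, toReal_one_div_ofReal_inv ht0]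
  obtain ⟨c, ⟨hc1, hc2, hc⟩, htc⟩ := lt_sSup_iff.1 hlt
  refine ⟨(1 / c).toReal, ENNReal.toReal_nonneg, ?_, ?_, toReal_one_div_le_one hc1, ?_⟩
  · rwa [← toReal_one_div_lt_iff hc1 h1, toReal_one_div_ofReal_inv ht0] at htc
  · simpa using (toReal_one_div_le_iff one_le_two hc1).2 hc2.le
  · rwa [toReal_two_div_conjExponent hc1] at hc

theorem toReal_one_div_criticalIndex_le (ν : Measure unitInterval) [IsFiniteMeasure ν] {t : ℝ}
    (ht : 1 / 2 < t) (ht1 : t ≤ 1)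
    (h : ∫⁻ r : unitInterval, 1 / ENNReal.ofReal (1 - (r : ℝ) ^ 2) ^ (2 * (1 - t)) ∂ν < ∞) :
    (1 / criticalIndex ν).toReal ≤ t := by
  have ht0 : 0 < t := by linarith
  have h1 := one_le_ofReal_inv ht0 ht1
  have hle : ENNReal.ofReal t⁻¹ ≤ criticalIndex ν := by
    refine le_sSup ⟨h1, ?_, ?_⟩
    · rw [← toReal_one_div_lt_iff one_le_two h1, toReal_one_div_ofReal_inv ht0]
      simpa using ht
    · rwa [toReal_two_div_conjExponent h1, toReal_one_div_ofReal_inv ht0]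
  rwa [← toReal_one_div_le_iff (one_le_criticalIndex ν) h1, toReal_one_div_ofReal_inv ht0] at hle

/-! ### Sufficiency and necessity in reciprocal exponents -/

theorem isBoundedLpLq_of_isPowerBounded {ν : Measure unitInterval} [IsFiniteMeasure ν] {s : ℝ}
    (h0 : 1 / 2 ≤ s) (h1 : s ≤ 1)
    (hν : ∫⁻ r : unitInterval, 1 / ENNReal.ofReal (1 - (r : ℝ) ^ 2) ^ (2 * (1 - s)) ∂ν < ∞)
    {p q : ℝ≥0∞} (h : IsPowerBounded (2 * s) p q) : IsBoundedLpLq ν p q := by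
  refine IsPowerBounded.isBoundedLpLq (a := 2 * (1 - s)) (by linarith) (by linarith) hν ?_
  rwa [show 2 - 2 * (1 - s) = 2 * s by ring]

theorem isBoundedLpLq_of_lt_conjExponent {ν : Measure unitInterval} [IsFiniteMeasure ν]
    {p q : ℝ≥0∞} (hp : 1 ≤ p) (h : (1 / p).toReal < 1 - (1 / criticalIndex ν).toReal) :
    IsBoundedLpLq ν p q := by
  have hx0 : 0 ≤ (1 / p).toReal := ENNReal.toReal_nonneg
  have hc0 : 0 ≤ (1 / criticalIndex ν).toReal := ENNReal.toReal_nonneg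
  set x := (1 / p).toReal with hx
  set t := (1 / criticalIndex ν).toReal with ht
  -- The midpoint of t and 1 - x: u > t leaves room for an admissible s < u, and u < 1 - x puts the
  -- exponent 1/(1 - u) below p. The pair 1/(1 - u), 1/u is conjugate, so the target is L^∞.
  set u := (t + 1 - x) / 2 with hu
  have hu0 : 0 < u := by linarith
  have hu1 : 0 < 1 - u := by linarith
  obtain ⟨s, hs0, hsu, hs, hs1, hfin⟩ := exists_lintegral_lt_top_of_lt ν (t := u) (by linarith)
    (by linarith)
  refine isBoundedLpLq_of_isPowerBounded hs hs1 hfin ?_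
  have hconj : ((1 - u)⁻¹).HolderConjugate u⁻¹ := by
    rw [Real.holderConjugate_iff]
    exact ⟨(one_lt_inv₀ hu1).2 (by linarith), by simp⟩
  have hbc : 2 * s * u⁻¹ < 2 := by
    rw [← div_eq_mul_inv, div_lt_iff₀ hu0]; linarith
  exact (isPowerBounded_ofReal_top (by linarith) hconj hbc).mono
    (ofReal_inv_le hp hu1 (by linarith) (by linarith)) le_top

theorem isBoundedLpLq_of_lt {ν : Measure unitInterval} [IsFiniteMeasure ν]
    {p q : ℝ≥0∞} (hp : 1 ≤ p) (hq : 1 ≤ q)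
    (h1 : 1 - (1 / criticalIndex ν).toReal ≤ (1 / p).toReal)
    (h2 : (1 / p).toReal + (1 / criticalIndex ν).toReal - 1 < (1 / q).toReal) :
    IsBoundedLpLq ν p q := by
  have hx0 : 0 ≤ (1 / p).toReal := ENNReal.toReal_nonneg
  have hx1 := toReal_one_div_le_one hp
  have hy1 := toReal_one_div_le_one hq
  have ht0 : 0 ≤ (1 / criticalIndex ν).toReal := ENNReal.toReal_nonneg
  have ht1 := toReal_one_div_le_one (one_le_criticalIndex ν)
  set x := (1 / p).toReal with hx
  set y := (1 / q).toReal with hy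
  set t := (1 / criticalIndex ν).toReal with ht
  rcases ht1.lt_or_eq with ht1 | ht1
  -- Young's inequality with 1/c = u leads from 1/p = x to v = x + u - 1. The first entry of the
  -- minimum keeps u < 1, the second gives v ≤ y, and u > t ≥ 1 - x gives v > 0.
  · set u := min ((1 + t) / 2) (1 + y - x) with hu
    have htu : t < u := lt_min (by linarith) (by linarith)
    have huy : u ≤ 1 + y - x := min_le_right _ _
    have hu1 : u < 1 := (min_le_left _ _).trans_lt (by linarith)
    have hu0 : 0 < u := by linarith
    have hx0 : 0 < x := by linarith
    set v := x + u - 1 with hv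
    have hv0 : 0 < v := by linarith
    obtain ⟨s, hs0, hsu, hs, hs1, hfin⟩ := exists_lintegral_lt_top_of_lt ν (t := u) hu1.le htu
    refine isBoundedLpLq_of_isPowerBounded hs hs1 hfin ?_
    have hbc : 2 * s * u⁻¹ < 2 := by
      rw [← div_eq_mul_inv, div_lt_iff₀ hu0]; linarith
    refine (isPowerBounded_ofReal (p := x⁻¹) (q := v⁻¹) (c := u⁻¹) (by linarith)
      ((one_le_inv₀ hx0).2 hx1) (inv_anti₀ hv0 (by linarith)) (by positivity)
      (by simp only [inv_inv]; linarith) hbc).mono ?_ ?_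
    · exact ofReal_inv_le hp hx0 hx1 le_rfl
    · exact le_ofReal_inv hq hv0 (by linarith) (by linarith)
  -- When c_ν = 1 the kernel exponent stays at 2, and the hypothesis reads x < y. An intermediate v
  -- keeps the source exponent finite even if p = ∞.
  · have hxy : x < y := by linarith
    set v := (x + y) / 2 with hv
    refine isBoundedLpLq_of_isPowerBounded (s := 1) (by norm_num) le_rfl (by simp) ?_
    rw [mul_one]
    refine (isPowerBounded_two (p := v⁻¹) (q := y⁻¹) ((one_le_inv₀ (by linarith)).2 hy1)
      (inv_strictAnti₀ (by linarith) (by linarith))).mono ?_ ?_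
    · exact ofReal_inv_le hp (by linarith) (by linarith) (by linarith)
    · exact le_ofReal_inv hq (by linarith) hy1 le_rfl

theorem IsBoundedLpLq.le_toReal_one_div {ν : Measure unitInterval} [IsFiniteMeasure ν]
    (hν : ν ≠ 0) {p q : ℝ≥0∞} (hp : 1 ≤ p) (hq : 1 ≤ q) (h : IsBoundedLpLq ν p q) :
    (1 / p).toReal + (1 / criticalIndex ν).toReal - 1 ≤ (1 / q).toReal := by
  have hp0 : p ≠ 0 := (zero_lt_one.trans_le hp).ne'
  have hq0 : q ≠ 0 := (zero_lt_one.trans_le hq).ne'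
  have hhalf := h.inv_sub_inv_le_half hν hp0 hq0
  have ht1 := toReal_one_div_le_one (one_le_criticalIndex ν)
  by_contra! hlt
  -- Such a t exceeds 1/2 by `hhalf`, so 1/t is an admissible exponent larger than c_ν, a
  -- contradiction.
  obtain ⟨t, hgt, hlt'⟩ := exists_between
    (show 1 - ((1 / p).toReal - (1 / q).toReal) < (1 / criticalIndex ν).toReal by linarith)
  have hfin := h.lintegral_lt_top hp0 hq0 (a := 2 * (1 - t)) (by linarith) (by linarith)
  have := toReal_one_div_criticalIndex_le ν (by linarith) (by linarith) hfin
  linarith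

end Shimorin

/-! ### The characterization -/

theorem theorem1 (ν : Measure unitInterval) [IsFiniteMeasure ν] (hν : ν ≠ 0)
    (p q : ℝ≥0∞) (hp : 1 ≤ p) (hq : 1 ≤ q) (hpq : (p, q) ∉ Shimorin.criticalLine ν) :
    Shimorin.IsBoundedLpLq ν p q ↔
      (p = 1 ∧ q < Shimorin.criticalIndex ν) ∨
      (1 < p ∧ p < (Shimorin.criticalIndex ν).conjExponent ∧
        (1 / p).toReal + (1 / Shimorin.criticalIndex ν).toReal - 1 < (1 / q).toReal) ∨
      (p = (Shimorin.criticalIndex ν).conjExponent ∧ q < ∞) ∨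
      (Shimorin.criticalIndex ν).conjExponent < p := by
  open Shimorin in
  have hc1 := one_le_criticalIndex ν
  have hc' := one_le_conjExponent (criticalIndex ν)
  have hconj := toReal_one_div_conjExponent hc1
  have hy0 : 0 ≤ (1 / q).toReal := ENNReal.toReal_nonneg
  have hx1 := toReal_one_div_le_one hp
  have ht : 1 / 2 ≤ (1 / criticalIndex ν).toReal := by
    simpa using (toReal_one_div_le_iff one_le_two hc1).2 (criticalIndex_le_two ν)
  have hone : (1 / (1 : ℝ≥0∞)).toReal = 1 := by simp
  have htop : (1 / (∞ : ℝ≥0∞)).toReal = 0 := by simp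
  simp only [criticalLine, Set.mem_ofPred_eq, not_and] at hpq
  have hpq' := fun h => hpq hp h hq
  rw [← toReal_one_div_le_iff hc' hp, hconj] at hpq'
  rw [← toReal_one_div_inj hp le_rfl, ← toReal_one_div_lt_iff hc1 hq,
    ← toReal_one_div_lt_iff hp le_rfl, ← toReal_one_div_lt_iff hc' hp,
    ← toReal_one_div_inj hp hc', ← toReal_one_div_lt_iff le_top hq,
    ← toReal_one_div_lt_iff hp hc', hconj, hone, htop]
  constructor
  · intro h
    have hle := h.le_toReal_one_div hν hp hq
    -- For x ≥ 1 - t the excluded segment rules out equality in `hle`. At x = 1 - t this says y > 0,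
    -- and at x = 1 it says y > t.
    rcases lt_trichotomy (1 / p).toReal (1 - (1 / criticalIndex ν).toReal) with h1 | h1 | h1
    · exact .inr (.inr (.inr h1))
    · exact .inr (.inr (.inl ⟨h1, hy0.lt_of_ne fun h0 => hpq' h1.ge (by linarith)⟩))
    · have hlt := hle.lt_of_ne fun h0 => hpq' h1.le h0.symm
      rcases hx1.lt_or_eq with h2 | h2
      · exact .inr (.inl ⟨h2, h1, hlt⟩)
      · exact .inl ⟨h2, by linarith⟩
  · rintro (⟨h1, h2⟩ | ⟨-, h1, h2⟩ | ⟨h1, h2⟩ | h1)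
    · exact isBoundedLpLq_of_lt hp hq (by linarith) (by linarith)
    · exact isBoundedLpLq_of_lt hp hq h1.le h2
    · exact isBoundedLpLq_of_lt hp hq h1.ge (by linarith)
    · exact isBoundedLpLq_of_lt_conjExponent hp h1
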